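/- Let $\mathfrak{S}_n$ be the set of permutations $\pi=\pi(1)\cdots\pi(n)$ of $[n]=\{1,\dots,n\}$. For $\pi\in\mathfrak{S}_n$ let $\mathrm{exc}(\pi)$, $\mathrm{drop}(\pi)$, $\mathrm{fix}(\pi)$ be the numbers of $i\in[n]$ with $\pi(i)>i$, $\pi(i)<i$, $\pi(i)=i$, respectively, and let $\mathrm{cyc}(\pi)$ be the number of cycles of $\pi$ (fixed points included). Let $\mathrm{lrmin}(\pi)$ (resp. $\mathrm{rlmin}(\pi)$) be the number of $i\in[n]$ such that $\pi(i)<\pi(j)$ for all $j<i$ (resp. for all $j>i$) in $[n]$. Put $$\mathrm{asc}^*(\pi)=\#\{i\in[n-1]:\pi(i)<\pi(i+1)\},\qquad \mathrm{des}^*(\pi)=\#\{i\in[n-1]:\pi(i)>\pi(i+1)\}.$$ Let $\mathrm{pasc}(\pi)$ be the number of $i$ with $2\le i\le n$ and $\pi(i-1)<\pi(i)$ such that, for all $j\in[n]$, $\pi(j)<\pi(i)$ implies $j<i$. Let $\mathrm{pdes}(\pi)$ be the number of $i\in[n-1]$ with $\pi(i)>\pi(i+1)$ such that, for all $j\in[n]$,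 $\pi(j)<\pi(i)$ implies $j>i$. Put $\mathrm{impasc}=\mathrm{asc}^*-\mathrm{pasc}$ and $\mathrm{impdes}=\mathrm{des}^*-\mathrm{pdes}$. Let $A_n(x)=\sum_{\pi\in\mathfrak{S}_n}x^{\mathrm{des}(\pi)}$ be the Eulerian polynomial, where $\mathrm{des}(\pi)=\#\{i\in[n]:\pi(i)>\pi(i+1)\}$ with $\pi(n+1)=0$. Then for every integer $n\ge 0$ the following polynomial identities hold; that is, they hold for all elements $x,y,p,q$ of any commutative ring: $$\sum_{\pi\in\mathfrak{S}_{n+1}}x^{\mathrm{pdes}(\pi)}y^{\mathrm{pasc}(\pi)}p^{\mathrm{lrmin}(\pi)-1}q^{\mathrm{rlmin}(\pi)-1}=\sum_{\pi\in\mathfrak{S}_n}(px+qy)^{\mathrm{fix}(\pi)}(p+q)^{\mathrm{cyc}(\pi)-\mathrm{fix}(\pi)};$$ $$\sum_{\pi\in\mathfrak{S}_{n+1}}x^{\mathrm{impdes}(\pi)}y^{\mathrm{impasc}(\pi)}p^{\mathrm{lrmin}(\pi)-1}q^{\mathrm{rlmin}(\pi)-1}=\sum_{\pi\in\mathfrak{S}_n}x^{\mathrm{exc}(\pi)}y^{\mathrm{drop}(\pi)}(p+q)^{\mathrm{cyc}(\pi)};$$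 $$\sum_{\pi\in\mathfrak{S}_{n+1}}x^{\mathrm{impdes}(\pi)}y^{\mathrm{pdes}(\pi)}=\sum_{\pi\in\mathfrak{S}_n}x^{\mathrm{exc}(\pi)}(1+y)^{\mathrm{fix}(\pi)}2^{\mathrm{cyc}(\pi)-\mathrm{fix}(\pi)};$$ $$A_{n+1}(x)=x\sum_{\pi\in\mathfrak{S}_{n+1}}x^{\mathrm{impdes}(\pi)+\mathrm{pdes}(\pi)}=\sum_{\pi\in\mathfrak{S}_n}x^{\mathrm{exc}(\pi)+1}(1+x)^{\mathrm{fix}(\pi)}2^{\mathrm{cyc}(\pi)-\mathrm{fix}(\pi)}.$$ -/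

import Mathlib

namespace PermStat

/-- Permutations of `[n] = {1, …, n}` are modelled by `Equiv.Perm (Fin n)`, with `Fin n = {0, …, n-1}`
standing for `[n]` by the order isomorphism `i ↦ i + 1`. `entry π i` is the letter `π(i) ∈ [n]`
at the position `i ∈ [n]` (both counted from `1`), with the convention that it is `0` at every
other position; in particular `π(0) = π(n+1) = 0`. -/
def entry {n : ℕ} (π : Equiv.Perm (Fin n)) (i : ℕ) : ℕ :=
  if h : 1 ≤ i ∧ i ≤ n then (π ⟨i - 1, by omega⟩ : ℕ) + 1 else 0

/-- The number of descents, with the convention `π(n+1) = 0`: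
`#{i ∈ [n] : π(i) > π(i+1)}` (so the last position always counts). -/
def des {n : ℕ} (π : Equiv.Perm (Fin n)) : ℕ :=
  ((Finset.Icc 1 n).filter fun i => entry π (i + 1) < entry π i).card

/-- `asc*`: the number of interior ascents, `#{i ∈ [n-1] : π(i) < π(i+1)}`. -/
def ascStar {n : ℕ} (π : Equiv.Perm (Fin n)) : ℕ :=
  ((Finset.Ico 1 n).filter fun i => entry π i < entry π (i + 1)).card

/-- `des*`: the number of interior descents, `#{i ∈ [n-1] : π(i) > π(i+1)}`. -/
def desStar {n : ℕ} (π : Equiv.Perm (Fin n)) : ℕ :=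
  ((Finset.Ico 1 n).filter fun i => entry π (i + 1) < entry π i).card

/-- `π(i)` is a proper ascent: `2 ≤ i ≤ n`, `π(i-1) < π(i)`, and every entry smaller than `π(i)`
lies to the left of `π(i)`. -/
def IsProperAscent {n : ℕ} (π : Equiv.Perm (Fin n)) (i : ℕ) : Prop :=
  (2 ≤ i ∧ i ≤ n) ∧ entry π (i - 1) < entry π i ∧
    ∀ j ∈ Finset.Icc 1 n, entry π j < entry π i → j < i

/-- `π(i)` is a proper descent: `1 ≤ i ≤ n-1`, `π(i) > π(i+1)`, and every entry smaller than `π(i)`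
lies to the right of `π(i)`. -/
def IsProperDescent {n : ℕ} (π : Equiv.Perm (Fin n)) (i : ℕ) : Prop :=
  (1 ≤ i ∧ i < n) ∧ entry π (i + 1) < entry π i ∧
    ∀ j ∈ Finset.Icc 1 n, entry π j < entry π i → i < j

instance {n : ℕ} (π : Equiv.Perm (Fin n)) (i : ℕ) : Decidable (IsProperAscent π i) := by
  unfold IsProperAscent; infer_instance

instance {n : ℕ} (π : Equiv.Perm (Fin n)) (i : ℕ) : Decidable (IsProperDescent π i) := by
  unfold IsProperDescent; infer_instance

/-- The number of proper ascents. -/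
def pasc {n : ℕ} (π : Equiv.Perm (Fin n)) : ℕ :=
  ((Finset.Icc 1 n).filter fun i => IsProperAscent π i).card

/-- The number of proper descents. -/
def pdes {n : ℕ} (π : Equiv.Perm (Fin n)) : ℕ :=
  ((Finset.Icc 1 n).filter fun i => IsProperDescent π i).card

/-- The number of improper ascents (no truncation occurs, see `pasc_le_ascStar`). -/
def impasc {n : ℕ} (π : Equiv.Perm (Fin n)) : ℕ := ascStar π - pasc π

/-- The number of improper descents (no truncation occurs, see `pdes_le_desStar`). -/
def impdes {n : ℕ} (π : Equiv.Perm (Fin n)) : ℕ := desStar π - pdes π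

/-- The number of left-to-right minima. -/
def lrmin {n : ℕ} (π : Equiv.Perm (Fin n)) : ℕ :=
  (Finset.univ.filter fun i : Fin n => ∀ j, j < i → π i < π j).card

/-- The number of right-to-left minima. -/
def rlmin {n : ℕ} (π : Equiv.Perm (Fin n)) : ℕ :=
  (Finset.univ.filter fun i : Fin n => ∀ j, i < j → π i < π j).card

/-- The number of excedances. -/
def exc {n : ℕ} (π : Equiv.Perm (Fin n)) : ℕ :=
  (Finset.univ.filter fun i : Fin n => i < π i).card

/-- The number of drops. -/
def drop {n : ℕ} (π : Equiv.Perm (Fin n)) : ℕ :=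
  (Finset.univ.filter fun i : Fin n => π i < i).card

/-- The number of fixed points. -/
def fix {n : ℕ} (π : Equiv.Perm (Fin n)) : ℕ :=
  (Finset.univ.filter fun i : Fin n => π i = i).card

/-- The number of cycles, fixed points included: the number of parts of the partition of `n` given
by the cycle lengths of `π`. -/
def cyc {n : ℕ} (π : Equiv.Perm (Fin n)) : ℕ := Multiset.card π.partition.parts

/-- The value at `x` of the classical Eulerian polynomial `A_n(x) = ∑_{π ∈ S_n} x^{des(π)}`. -/
def eulerian {R : Type*} [CommRing R] (n : ℕ) (x : R) : R :=
  ∑ π : Equiv.Perm (Fin n), x ^ des π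

theorem pasc_le_ascStar {n : ℕ} (π : Equiv.Perm (Fin n)) : pasc π ≤ ascStar π := by
  refine Finset.card_le_card_of_injOn (fun i => i - 1) ?_ ?_
  · intro i hi
    obtain ⟨-, ⟨h2, hn⟩, h, -⟩ := Finset.mem_filter.1 hi
    refine Finset.mem_filter.2 ⟨Finset.mem_Ico.2 ⟨?_, ?_⟩, ?_⟩
    · show 1 ≤ i - 1
      omega
    · show i - 1 < n
      omega
    show entry π (i - 1) < entry π (i - 1 + 1)
    rwa [Nat.sub_add_cancel (by omega)]
  · intro i hi j hj hij
    obtain ⟨-, ⟨hi2, -⟩, -⟩ := Finset.mem_filter.1 hi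
    obtain ⟨-, ⟨hj2, -⟩, -⟩ := Finset.mem_filter.1 hj
    simp only at hij
    omega

theorem pdes_le_desStar {n : ℕ} (π : Equiv.Perm (Fin n)) : pdes π ≤ desStar π := by
  refine Finset.card_le_card fun i hi => ?_
  obtain ⟨-, h1, h, -⟩ := Finset.mem_filter.1 hi
  exact Finset.mem_filter.2 ⟨Finset.mem_Ico.2 h1, h⟩

theorem cyc_eq {n : ℕ} (π : Equiv.Perm (Fin n)) :
    cyc π = Multiset.card π.cycleType + fix π := by
  have h := Finset.card_compl π.support
  have e : π.supportᶜ = Finset.univ.filter fun i : Fin n => π i = i := by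
    ext i; simp
  rw [e] at h
  simp [cyc, fix, Equiv.Perm.partition, h]

/-- The subtraction in the exponent `cyc - fix` is not truncated. -/
theorem fix_le_cyc {n : ℕ} (π : Equiv.Perm (Fin n)) : fix π ≤ cyc π := by
  rw [cyc_eq]; omega

/-- The subtraction in the exponent `lrmin - 1` is not truncated for `n ≥ 1`. -/
theorem one_le_lrmin {n : ℕ} (π : Equiv.Perm (Fin (n + 1))) : 1 ≤ lrmin π :=
  Finset.card_pos.2 ⟨0, by simp⟩

/-- The subtraction in the exponent `rlmin - 1` is not truncated for `n ≥ 1`. -/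
theorem one_le_rlmin {n : ℕ} (π : Equiv.Perm (Fin (n + 1))) : 1 ≤ rlmin π :=
  Finset.card_pos.2 ⟨Fin.last n, by
    simp only [Finset.mem_filter, Finset.mem_univ, true_and]
    intro j hj
    exact absurd (Fin.le_last j) (not_le.2 hj)⟩

end PermStat

namespace PermStat

open Equiv Finset

/-! All the generating-function identities specialise one identity in six variables,
`sum_perm_refined`: words on `n + 1` letters, weighted by `u`, `u'`, `v`, `v'` per kind of gap and
by `p`, `q` per extra minimum, match permutations of `n` points, weighted by `u`, `v`, `f = p u' + q
v'` per excedance, drop, fixed point and by `g = p + q` per nontrivial cycle.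

Both sums start at 1 and satisfy `W ↦ f W + D W`, where `D` is the derivation sending each of `u`,
`u'`, `v`, `v'` to `uv` and killing `p`, `q`. Inserting a new largest letter in a word at the front
gives `p u'`, at the end `q v'`, and inside a gap replaces the weight of that gap by `uv`; summing
over gaps is the Leibniz rule for `D`. On the other side, inserting a new smallest point as a fixed
point gives `f`; inserting it into an arc replaces the arc by a drop and an excedance, and breaking
a loop also creates a cycle, which agrees with `D f = uv g`. -/

/-- The word obtained from `π` by inserting a new largest letter at position `k`. -/
def insertMax {n : ℕ} (k : Fin (n + 1)) (π : Perm (Fin n)) : Perm (Fin (n + 1)) :=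
  (finSuccEquiv' k).trans ((optionCongr π).trans (finSuccEquiv' (Fin.last n)).symm)

@[simp]
theorem insertMax_apply_self {n : ℕ} (k : Fin (n + 1)) (π : Perm (Fin n)) :
    insertMax k π k = Fin.last n := by
  simp [insertMax]

@[simp]
theorem insertMax_apply_succAbove {n : ℕ} (k : Fin (n + 1)) (π : Perm (Fin n)) (j : Fin n) :
    insertMax k π (k.succAbove j) = (π j).castSucc := by
  simp [insertMax]

theorem insertMax_bijective (n : ℕ) :
    Function.Bijective fun a : Fin (n + 1) × Perm (Fin n) => insertMax a.1 a.2 := by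
  rw [Fintype.bijective_iff_injective_and_card]
  refine ⟨?_, by simp [Fintype.card_perm, Nat.factorial_succ]⟩
  rintro ⟨k, π⟩ ⟨l, τ⟩ h
  simp only at h
  have hkl : k = l := by
    apply (insertMax k π).injective
    rw [insertMax_apply_self, h, insertMax_apply_self]
  subst hkl
  refine Prod.ext rfl (Equiv.ext fun j => ?_)
  have := congrArg (fun σ : Perm (Fin (n + 1)) => σ (k.succAbove j)) h
  simpa using this

theorem sum_perm_insertMax {M : Type*} [AddCommMonoid M] (n : ℕ) (f : Perm (Fin (n + 1)) → M) :
    ∑ σ, f σ = ∑ π : Perm (Fin n), ∑ k, f (insertMax k π) := by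
  rw [← (insertMax_bijective n).sum_comp f, Fintype.sum_prod_type, sum_comm]

/-! ### Words: inserting a new largest letter -/

section Weight

variable {A : Type*}

/-- The weight of the pair of adjacent letters at positions `i`, `i + 1`: `u` for an improper
descent, `u'` for a proper descent, `v` for an improper ascent, `v'` for a proper ascent. -/
def gapWeight (u u' v v' : A) {n : ℕ} (π : Perm (Fin (n + 1))) (i : Fin n) : A :=
  if π i.succ < π i.castSucc then
    if ∀ j, π j < π i.castSucc → i.castSucc < j then u' else u
  else if ∀ j, π j < π i.succ → j < i.succ then v' else v

/-- Properness of a gap only tests letters smaller than a given one, so a new largest letter outside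
the gap is invisible. The hypotheses say that gap `j` of the new word carries the two letters of gap
`i`. -/
theorem gapWeight_insertMax (u u' v v' : A) {n : ℕ} (π : Perm (Fin (n + 1)))
    {k : Fin (n + 2)} {i : Fin n} {j : Fin (n + 1)}
    (h₁ : j.castSucc = k.succAbove i.castSucc) (h₂ : j.succ = k.succAbove i.succ) :
    gapWeight u u' v v' (insertMax k π) j = gapWeight u u' v v' π i := by
  unfold gapWeight
  rw [h₁, h₂]
  simp only [Fin.forall_iff_succAbove k, insertMax_apply_succAbove, insertMax_apply_self,
    Fin.castSucc_lt_castSucc_iff, Fin.succAbove_lt_succAbove_iff,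
    not_lt_of_ge (Fin.le_last _), false_imp_iff, true_and]

theorem lrmin_insertMax_zero {n : ℕ} (π : Perm (Fin (n + 1))) :
    lrmin (insertMax 0 π) = lrmin π + 1 := by
  simp only [lrmin, card_filter]
  rw [Fin.sum_univ_succAbove _ 0]
  simp only [Fin.forall_iff_succAbove (0 : Fin (n + 2)), insertMax_apply_succAbove, insertMax_apply_self,
    Fin.castSucc_lt_castSucc_iff, Fin.succAbove_lt_succAbove_iff, Fin.castSucc_lt_last]
  simp [add_comm]

theorem rlmin_insertMax_last {n : ℕ} (π : Perm (Fin (n + 1))) :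
    rlmin (insertMax (Fin.last _) π) = rlmin π + 1 := by
  simp only [rlmin, card_filter]
  rw [Fin.sum_univ_succAbove _ (Fin.last _)]
  simp only [Fin.forall_iff_succAbove (Fin.last (n + 1)), insertMax_apply_succAbove,
    insertMax_apply_self, Fin.castSucc_lt_castSucc_iff, Fin.succAbove_lt_succAbove_iff,
    Fin.castSucc_lt_last]
  simp [add_comm, not_lt_of_ge (Fin.le_last _)]

theorem lrmin_insertMax_of_ne {n : ℕ} (π : Perm (Fin (n + 1))) {k : Fin (n + 2)} (hk : k ≠ 0) :
    lrmin (insertMax k π) = lrmin π := by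
  have h : ¬ ∀ j, j < k → insertMax k π k < insertMax k π j := fun h =>
    not_lt_of_ge (Fin.le_last _) (insertMax_apply_self k π ▸ h 0 (Fin.pos_of_ne_zero hk))
  simp only [lrmin, card_filter]
  rw [Fin.sum_univ_succAbove _ k, if_neg h]
  simp only [Fin.forall_iff_succAbove k, insertMax_apply_succAbove, insertMax_apply_self,
    Fin.castSucc_lt_castSucc_iff, Fin.succAbove_lt_succAbove_iff, Fin.castSucc_lt_last,
    implies_true, true_and, zero_add]

theorem rlmin_insertMax_of_ne {n : ℕ} (π : Perm (Fin (n + 1))) {k : Fin (n + 2)}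
    (hk : k ≠ Fin.last _) : rlmin (insertMax k π) = rlmin π := by
  have h : ¬ ∀ j, k < j → insertMax k π k < insertMax k π j := fun h =>
    not_lt_of_ge (Fin.le_last _) (insertMax_apply_self k π ▸ h _ (Fin.lt_last_iff_ne_last.2 hk))
  simp only [rlmin, card_filter]
  rw [Fin.sum_univ_succAbove _ k, if_neg h]
  simp only [Fin.forall_iff_succAbove k, insertMax_apply_succAbove, insertMax_apply_self,
    Fin.castSucc_lt_castSucc_iff, Fin.succAbove_lt_succAbove_iff, Fin.castSucc_lt_last,
    implies_true, true_and, zero_add]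

variable [CommRing A]

theorem prod_gapWeight_insertMax_zero (u u' v v' : A) {n : ℕ} (π : Perm (Fin (n + 1))) :
    ∏ i, gapWeight u u' v v' (insertMax 0 π) i = u' * ∏ i, gapWeight u u' v v' π i := by
  rw [Fin.prod_univ_succ]
  congr 1
  · have h : insertMax 0 π (Fin.succ 0) = (π 0).castSucc := insertMax_apply_succAbove 0 π 0
    simp only [gapWeight, h, Fin.castSucc_zero, insertMax_apply_self, Fin.castSucc_lt_last, if_true]
    rw [if_pos]
    intro j hj
    refine Fin.pos_of_ne_zero fun h0 => ?_
    simp [h0] at hj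
  · exact prod_congr rfl fun i _ => gapWeight_insertMax _ _ _ _ _ (by simp) (by simp)

theorem prod_gapWeight_insertMax_last (u u' v v' : A) {n : ℕ} (π : Perm (Fin (n + 1))) :
    ∏ i, gapWeight u u' v v' (insertMax (Fin.last _) π) i
      = v' * ∏ i, gapWeight u u' v v' π i := by
  rw [Fin.prod_univ_castSucc, mul_comm]
  congr 1
  · have h : insertMax (Fin.last _) π (Fin.castSucc (Fin.last n)) = (π (Fin.last n)).castSucc := by
      simpa using insertMax_apply_succAbove (Fin.last _) π (Fin.last n)
    simp only [gapWeight, h, Fin.succ_last, insertMax_apply_self]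
    rw [if_neg (not_lt_of_ge (Fin.le_last _)), if_pos]
    intro j hj
    refine Fin.lt_last_iff_ne_last.2 fun h0 => ?_
    simp [h0] at hj
  · exact prod_congr rfl fun i _ => gapWeight_insertMax _ _ _ _ _ (by simp) (by simp)

/-- The maximum has a smaller neighbour on each side, so neither the ascent into it nor the descent
out of it is proper, whatever the old gap was. -/
theorem prod_gapWeight_insertMax_gap (u u' v v' : A) {n : ℕ} (π : Perm (Fin (n + 1)))
    (i : Fin n) :
    ∏ j, gapWeight u u' v v' (insertMax i.succ.castSucc π) j
      = u * v * ∏ j ∈ univ.erase i, gapWeight u u' v v' π j := by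
  have hl : insertMax i.succ.castSucc π i.castSucc.castSucc = (π i.castSucc).castSucc := by
    rw [← insertMax_apply_succAbove i.succ.castSucc π, Fin.succAbove_of_castSucc_lt]
    simp [Fin.lt_def]
  have hr : insertMax i.succ.castSucc π i.succ.succ = (π i.succ).castSucc := by
    rw [← insertMax_apply_succAbove i.succ.castSucc π, Fin.succAbove_of_le_castSucc]
    simp
  have hm : insertMax i.succ.castSucc π i.castSucc.succ = Fin.last _ := by
    rw [Fin.succ_castSucc, insertMax_apply_self]
  have hm' : insertMax i.succ.castSucc π i.succ.castSucc = Fin.last _ := insertMax_apply_self _ _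
  have h1 : gapWeight u u' v v' (insertMax i.succ.castSucc π) i.castSucc = v := by
    simp only [gapWeight, hl, hm]
    rw [if_neg (not_lt_of_ge (Fin.le_last _)), if_neg]
    intro h
    have := h i.succ.succ (by rw [hr]; exact Fin.castSucc_lt_last _)
    simp [Fin.lt_def] at this
  have h2 : gapWeight u u' v v' (insertMax i.succ.castSucc π) i.succ = u := by
    simp only [gapWeight, hr, hm']
    rw [if_pos (Fin.castSucc_lt_last _), if_neg]
    intro h
    have := h i.castSucc.castSucc (by rw [hl]; exact Fin.castSucc_lt_last _)
    simp [Fin.lt_def] at this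
  rw [Fin.prod_univ_succAbove _ i.castSucc, h1, ← mul_prod_erase univ _ (mem_univ i),
    Fin.succAbove_castSucc_self, h2, ← mul_assoc, mul_comm v u]
  congr 1
  refine prod_congr rfl fun j hj => ?_
  have hne : (j : ℕ) ≠ i := fun h => (mem_erase.1 hj).1 (Fin.ext h)
  apply gapWeight_insertMax
  · ext
    simp only [Fin.succAbove, Fin.lt_def]
    split_ifs <;> simp_all <;> omega
  · ext
    simp only [Fin.succAbove, Fin.lt_def]
    split_ifs <;> simp_all <;> omega

/-- The weight of a word. -/
def wordWeight (u u' v v' p q : A) {n : ℕ} (π : Perm (Fin (n + 1))) : A :=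
  (∏ i, gapWeight u u' v v' π i) * (p ^ (lrmin π - 1) * q ^ (rlmin π - 1))

theorem derivation_prod {ι : Type*} [DecidableEq ι] (D : Derivation ℤ A A) (s : Finset ι)
    (f : ι → A) : D (∏ i ∈ s, f i) = ∑ i ∈ s, (∏ j ∈ s.erase i, f j) * D (f i) := by
  induction s using Finset.induction_on with
  | empty => simp
  | insert a s ha ih =>
    rw [prod_insert ha, D.leibniz, ih, sum_insert ha, erase_insert ha, smul_eq_mul, smul_eq_mul,
      add_comm, mul_sum]
    congr 1
    refine sum_congr rfl fun i hi => ?_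
    have hia : a ≠ i := fun h => ha (h ▸ hi)
    rw [erase_insert_of_ne hia, prod_insert fun h => ha (mem_of_mem_erase h), mul_assoc]

/-- The two end insertions give the scalar factor; the interior ones give `D`, since `D` takes every
gap weight to `u * v`. -/
theorem sum_wordWeight_succ {u u' v v' p q : A} {D : Derivation ℤ A A} (hu : D u = u * v)
    (hu' : D u' = u * v) (hv : D v = u * v) (hv' : D v' = u * v) (hp : D p = 0) (hq : D q = 0)
    (n : ℕ) :
    ∑ σ : Perm (Fin (n + 2)), wordWeight u u' v v' p q σ
      = (p * u' + q * v') * (∑ π : Perm (Fin (n + 1)), wordWeight u u' v v' p q π)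
        + D (∑ π : Perm (Fin (n + 1)), wordWeight u u' v v' p q π) := by
  rw [sum_perm_insertMax, map_sum, mul_sum, ← sum_add_distrib]
  refine sum_congr rfl fun π _ => ?_
  have hD : D (wordWeight u u' v v' p q π)
      = ∑ i : Fin n, wordWeight u u' v v' p q (insertMax i.succ.castSucc π) := by
    have hg (i : Fin n) : D (gapWeight u u' v v' π i) = u * v := by
      unfold gapWeight; split_ifs <;> assumption
    have hpq : D (p ^ (lrmin π - 1) * q ^ (rlmin π - 1)) = 0 := by
      simp [D.leibniz, D.leibniz_pow, hp, hq]
    rw [wordWeight, D.leibniz, hpq, derivation_prod, smul_zero, zero_add, smul_eq_mul, mul_sum]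
    refine sum_congr rfl fun i _ => ?_
    rw [hg, wordWeight, prod_gapWeight_insertMax_gap, lrmin_insertMax_of_ne,
      rlmin_insertMax_of_ne]
    · ring
    · simp [Fin.ext_iff]; omega
    · simp [Fin.ext_iff]
  have hl : lrmin π - 1 + 1 = lrmin π := Nat.sub_add_cancel (one_le_lrmin π)
  have hr : rlmin π - 1 + 1 = rlmin π := Nat.sub_add_cancel (one_le_rlmin π)
  have h0 : wordWeight u u' v v' p q (insertMax 0 π)
      = p * u' * wordWeight u u' v v' p q π := by
    rw [wordWeight, wordWeight, prod_gapWeight_insertMax_zero, lrmin_insertMax_zero,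
      rlmin_insertMax_of_ne π (by simp [Fin.ext_iff]), Nat.add_sub_cancel]
    conv_lhs => rw [← hl, pow_succ]
    ring
  have h1 : wordWeight u u' v v' p q (insertMax (Fin.last _) π)
      = q * v' * wordWeight u u' v v' p q π := by
    rw [wordWeight, wordWeight, prod_gapWeight_insertMax_last, rlmin_insertMax_last,
      lrmin_insertMax_of_ne π (by simp [Fin.ext_iff]), Nat.add_sub_cancel]
    conv_lhs => rw [← hr, pow_succ]
    ring
  rw [Fin.sum_univ_castSucc, Fin.sum_univ_succ, hD, h1, Fin.castSucc_zero, h0]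
  ring

end Weight

/-! ### Cycles: inserting a new smallest point -/

/-- Multiplying by the transposition inserts the fixed point `a` into the cycle of `b`; the number
of nontrivial cycles grows only when `b` was fixed too. -/
theorem card_cycleType_swap_mul {α : Type*} [Fintype α] [DecidableEq α] {σ : Perm α} {a b : α}
    (ha : σ a = a) (hab : a ≠ b) :
    Multiset.card (swap a b * σ).cycleType
      = Multiset.card σ.cycleType + if σ b = b then 1 else 0 := by
  split_ifs with hb
  · have hd : (swap a b).Disjoint σ := fun z => by
      by_cases hza : z = a
      · exact Or.inr (hza ▸ ha)
      by_cases hzb : z = b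
      · exact Or.inr (hzb ▸ hb)
      · exact Or.inl (swap_apply_of_ne_of_ne hza hzb)
    rw [hd.cycleType_mul, Multiset.card_add, (Perm.isCycle_swap hab).cycleType, add_comm]
    simp
  -- Argue backwards: the cycle `c` of `τ` through `a` has length at least 3, so undoing the
  -- transposition deletes `a` from `c` and leaves a single cycle.
  · set τ := swap a b * σ with hτ
    have hτa : τ a = b := by simp [hτ, ha]
    have hτb : τ (τ a) ≠ a := by
      intro h
      rw [hτa, hτ, Perm.mul_apply, swap_apply_eq_iff, swap_apply_left] at h
      exact hb h
    have hne : τ a ≠ a := hτa ▸ hab.symm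
    set c := τ.cycleOf a with hc
    have hcyc : c.IsCycle := Perm.isCycle_cycleOf τ hne
    have hca : c a = b := by rw [hc, Perm.cycleOf_apply_self, hτa]
    have hcca : c (c a) ≠ a := by
      have : c (c a) = τ (τ a) := by
        rw [hca, ← hτa, hc, Perm.SameCycle.cycleOf_apply]
        exact (Perm.sameCycle_apply_right).2 (Perm.SameCycle.refl _ _)
      rwa [this]
    have hd : (τ * c⁻¹).Disjoint c := Perm.disjoint_mul_inv_of_mem_cycleFactorsFinset
      (Perm.cycleOf_mem_cycleFactorsFinset_iff.2 (Perm.mem_support.2 hne))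
    have hs : (swap a b * c).IsCycle := by
      have := hcyc.swap_mul (x := a) (by rw [hca]; exact hab.symm) hcca
      rwa [hca] at this
    have hd' : (swap a b * c).Disjoint (τ * c⁻¹) := by
      refine fun z => (hd z).symm.imp_left fun hz => ?_
      have hza : z ≠ a := fun h => hab (by rw [← hca, ← h, hz, h])
      have hzb : z ≠ b := fun h => hab (c.injective (by rw [hca, ← h, hz]))
      rw [Perm.mul_apply, hz, swap_apply_of_ne_of_ne hza hzb]
    have hσ : σ = (swap a b * c) * (τ * c⁻¹) := by
      have : c * (τ * c⁻¹) = τ := by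
        rw [← hd.commute.eq, inv_mul_cancel_right]
      rw [mul_assoc, this, hτ, swap_mul_self_mul]
    have e1 : Multiset.card τ.cycleType = Multiset.card (τ * c⁻¹).cycleType + 1 := by
      conv_lhs => rw [← inv_mul_cancel_right τ c]
      rw [hd.cycleType_mul, Multiset.card_add, hcyc.cycleType, Multiset.card_singleton]
    rw [e1, add_zero]
    conv_rhs => rw [hσ]
    rw [hd'.cycleType_mul, Multiset.card_add, hs.cycleType, Multiset.card_singleton, add_comm]

theorem cycleType_decomposeFin_symm_zero {n : ℕ} (e : Perm (Fin n)) :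
    (Perm.decomposeFin.symm (0, e)).cycleType = e.cycleType := by
  rw [← Perm.cycleType_extendDomain (finSuccAboveEquiv (0 : Fin (n + 1))) (g := e)]
  congr 1
  ext i : 1
  refine Fin.cases ?_ (fun j => ?_) i
  · rw [Perm.extendDomain_apply_not_subtype _ _ (by simp)]
    simp
  · have h := Perm.extendDomain_apply_image e (finSuccAboveEquiv (0 : Fin (n + 1))) j
    simp only [finSuccAboveEquiv_apply, Fin.succAbove_zero] at h
    rw [h]
    simp

theorem decomposeFin_symm_eq {n : ℕ} (k : Fin (n + 1)) (e : Perm (Fin n)) :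
    Perm.decomposeFin.symm (k, e) = swap 0 k * Perm.decomposeFin.symm (0, e) := by
  ext i : 1
  refine Fin.cases ?_ (fun j => ?_) i <;> simp

/-- With `k = (e i).succ`, the arc `i → e i` is replaced by `i.succ → 0 → (e i).succ`. -/
theorem card_cycleType_decomposeFin_symm {n : ℕ} (e : Perm (Fin n)) (i : Fin n) :
    Multiset.card (Perm.decomposeFin.symm ((e i).succ, e)).cycleType
      = Multiset.card e.cycleType + if e i = i then 1 else 0 := by
  rw [decomposeFin_symm_eq, card_cycleType_swap_mul (by simp) (Fin.succ_ne_zero _).symm,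
    cycleType_decomposeFin_symm_zero]
  simp [Fin.succ_inj]

section Weight

variable {A : Type*} [CommRing A]

/-- The weight of the arc `i → σ i`. -/
def arcWeight (u v f : A) {n : ℕ} (σ : Perm (Fin n)) (i : Fin n) : A :=
  if i < σ i then u else if σ i < i then v else f

theorem prod_arcWeight (u v f : A) {n : ℕ} (σ : Perm (Fin n)) :
    ∏ i, arcWeight u v f σ i = u ^ exc σ * v ^ drop σ * f ^ fix σ := by
  have (i : Fin n) : arcWeight u v f σ i = (if i < σ i then u else 1) *
      (if σ i < i then v else 1) * (if σ i = i then f else 1) := by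
    unfold arcWeight
    rcases lt_trichotomy i (σ i) with h | h | h
    · simp [h, h.not_gt, h.ne']
    · simp [← h]
    · simp [h, h.not_gt, h.ne]
  simp only [this, prod_mul_distrib, prod_ite, prod_const, one_pow, mul_one, exc, drop, fix]

theorem prod_arcWeight_decomposeFin_symm_zero (u v f : A) {n : ℕ} (e : Perm (Fin n)) :
    ∏ i, arcWeight u v f (Perm.decomposeFin.symm (0, e)) i = f * ∏ i, arcWeight u v f e i := by
  rw [Fin.prod_univ_succ]
  simp [arcWeight]

theorem prod_arcWeight_decomposeFin_symm_succ (u v f : A) {n : ℕ} (e : Perm (Fin n))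
    (i : Fin n) :
    ∏ j, arcWeight u v f (Perm.decomposeFin.symm ((e i).succ, e)) j
      = u * v * ∏ j ∈ univ.erase i, arcWeight u v f e j := by
  rw [Fin.prod_univ_succ, ← mul_prod_erase univ _ (mem_univ i), ← mul_assoc]
  congr 1
  · simp [arcWeight]
  · refine prod_congr rfl fun j hj => ?_
    have h : e j ≠ e i := fun h => (mem_erase.1 hj).1 (e.injective h)
    simp [arcWeight, swap_apply_of_ne_of_ne (Fin.succ_ne_zero _) (mt (Fin.succ_inj.1) h)]

/-- The weight of a permutation in cycle notation. -/
def cycleWeight (u v f g : A) {n : ℕ} (σ : Perm (Fin n)) : A :=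
  (∏ i, arcWeight u v f σ i) * g ^ Multiset.card σ.cycleType

theorem sum_cycleWeight_succ {u v f g : A} {D : Derivation ℤ A A} (hu : D u = u * v)
    (hv : D v = u * v) (hf : D f = u * v * g) (hg : D g = 0) (n : ℕ) :
    ∑ σ : Perm (Fin (n + 1)), cycleWeight u v f g σ
      = f * (∑ e : Perm (Fin n), cycleWeight u v f g e)
        + D (∑ e : Perm (Fin n), cycleWeight u v f g e) := by
  rw [← Perm.decomposeFin.symm.sum_comp, Fintype.sum_prod_type, sum_comm, map_sum, mul_sum,
    ← sum_add_distrib]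
  refine sum_congr rfl fun e _ => ?_
  -- Reindexing by `e` labels each insertion by the source of the arc it breaks.
  rw [Fin.sum_univ_succ, ← Equiv.sum_comp e]
  congr 1
  · rw [cycleWeight, prod_arcWeight_decomposeFin_symm_zero, cycleType_decomposeFin_symm_zero,
      cycleWeight, mul_assoc]
  · have hgD : D (g ^ Multiset.card e.cycleType) = 0 := by simp [D.leibniz_pow, hg]
    rw [cycleWeight, D.leibniz, hgD, derivation_prod, smul_zero, zero_add, smul_eq_mul, mul_sum]
    refine sum_congr rfl fun i _ => ?_
    have hD : D (arcWeight u v f e i) = u * v * g ^ (if e i = i then 1 else 0) := by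
      unfold arcWeight
      rcases lt_trichotomy i (e i) with h | h | h
      · simp [h, h.ne', hu]
      · simp [← h, hf]
      · simp [h, h.not_gt, h.ne, hv]
    rw [cycleWeight, prod_arcWeight_decomposeFin_symm_succ, card_cycleType_decomposeFin_symm, hD,
      pow_add]
    ring

theorem sum_wordWeight_eq_sum_cycleWeight_of_derivation {u u' v v' p q : A}
    {D : Derivation ℤ A A} (hu : D u = u * v)
    (hu' : D u' = u * v) (hv : D v = u * v) (hv' : D v' = u * v) (hp : D p = 0) (hq : D q = 0)
    (n : ℕ) :
    ∑ π : Perm (Fin (n + 1)), wordWeight u u' v v' p q π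
      = ∑ σ : Perm (Fin n), cycleWeight u v (p * u' + q * v') (p + q) σ := by
  induction n with
  | zero =>
    simp [wordWeight, cycleWeight, lrmin, rlmin]
  | succ n ih =>
    rw [sum_wordWeight_succ hu hu' hv hv' hp hq, sum_cycleWeight_succ hu hv _ _, ih]
    · simp [D.leibniz, hp, hq, hu', hv']; ring
    · simp [hp, hq]

end Weight

/-! ### Reduction to the universal polynomial ring -/

section Map

variable {A B : Type*} [CommRing A] [CommRing B]

theorem map_wordWeight (φ : A →+* B) (u u' v v' p q : A) {n : ℕ} (π : Perm (Fin (n + 1))) :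
    φ (wordWeight u u' v v' p q π) = wordWeight (φ u) (φ u') (φ v) (φ v') (φ p) (φ q) π := by
  simp only [wordWeight, gapWeight, map_mul, map_pow, map_prod, apply_ite φ]

theorem map_cycleWeight (φ : A →+* B) (u v f g : A) {n : ℕ} (σ : Perm (Fin n)) :
    φ (cycleWeight u v f g σ) = cycleWeight (φ u) (φ v) (φ f) (φ g) σ := by
  simp only [cycleWeight, arcWeight, map_mul, map_pow, map_prod, apply_ite φ]

theorem sum_wordWeight_eq_sum_cycleWeight (u u' v v' p q : A) (n : ℕ) :
    ∑ π : Perm (Fin (n + 1)), wordWeight u u' v v' p q π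
      = ∑ σ : Perm (Fin n), cycleWeight u v (p * u' + q * v') (p + q) σ := by
  let X (i : Fin 6) : MvPolynomial (Fin 6) ℤ := MvPolynomial.X i
  let D : Derivation ℤ (MvPolynomial (Fin 6) ℤ) (MvPolynomial (Fin 6) ℤ) :=
    MvPolynomial.mkDerivation ℤ fun i => if i < 4 then X 0 * X 2 else 0
  have hD (i : Fin 6) : D (X i) = if i < 4 then X 0 * X 2 else 0 :=
    MvPolynomial.mkDerivation_X _ _ _
  have h := sum_wordWeight_eq_sum_cycleWeight_of_derivation (D := D) (u := X 0) (u' := X 1)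
    (v := X 2) (v' := X 3) (p := X 4) (q := X 5) (hD 0) (hD 1) (hD 2) (hD 3) (hD 4) (hD 5) n
  let φ := MvPolynomial.eval₂Hom (Int.castRingHom A) ![u, u', v, v', p, q]
  have hφ (i : Fin 6) : φ (X i) = ![u, u', v, v', p, q] i := MvPolynomial.eval₂Hom_X' _ _ _
  have h' := congrArg φ h
  simpa [map_sum, map_wordWeight, map_cycleWeight, hφ] using h'

end Map

/-! ### Identifying the weights with the statistics -/

theorem entry_succ {n : ℕ} (π : Perm (Fin n)) (i : Fin n) : entry π (i + 1) = π i + 1 := by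
  simp [entry]

theorem forall_mem_Icc_iff {n : ℕ} {P : ℕ → Prop} :
    (∀ j ∈ Icc 1 n, P j) ↔ ∀ j : Fin n, P (j + 1) := by
  refine ⟨fun h j => h _ (mem_Icc.2 ⟨by omega, by omega⟩), fun h j hj => ?_⟩
  obtain ⟨h1, h2⟩ := mem_Icc.1 hj
  simpa [Nat.sub_add_cancel h1] using h ⟨j - 1, by omega⟩

theorem card_filter_eq_card_filter_fin {n : ℕ} {s : Finset ℕ} {P : ℕ → Prop} [DecidablePred P]
    {Q : Fin n → Prop} [DecidablePred Q] (c : ℕ)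
    (hs : ∀ i, i ∈ s → P i → c ≤ i ∧ i < n + c)
    (hPQ : ∀ i : Fin n, ((i : ℕ) + c ∈ s ∧ P (i + c)) ↔ Q i) :
    (s.filter P).card = (univ.filter Q).card := by
  symm
  refine card_bij (fun i _ => (i : ℕ) + c) (fun i hi => ?_) (fun i _ j _ h => ?_)
    fun i hi => ?_
  · exact mem_filter.2 ((hPQ i).2 (mem_filter.1 hi).2)
  · exact Fin.ext (Nat.add_right_cancel h)
  · obtain ⟨h1, h2⟩ := mem_filter.1 hi
    obtain ⟨h3, h4⟩ := hs i h1 h2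
    have h5 : i - c + c = i := Nat.sub_add_cancel h3
    refine ⟨⟨i - c, by omega⟩, mem_filter.2 ⟨mem_univ _, (hPQ _).1 ?_⟩, h5⟩
    simpa only [h5] using And.intro h1 h2

theorem desStar_eq {n : ℕ} (π : Perm (Fin (n + 1))) :
    desStar π = (univ.filter fun i : Fin n => π i.succ < π i.castSucc).card := by
  refine card_filter_eq_card_filter_fin 1 (fun i hi _ => by simpa using hi) fun i => ?_
  have h1 := entry_succ π i.castSucc
  have h2 := entry_succ π i.succ
  simp only [Fin.val_castSucc, Fin.val_succ] at h1 h2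
  simp only [mem_Ico, h1, h2, Fin.lt_def]
  have := i.isLt
  omega

theorem ascStar_eq {n : ℕ} (π : Perm (Fin (n + 1))) :
    ascStar π = (univ.filter fun i : Fin n => ¬ π i.succ < π i.castSucc).card := by
  refine card_filter_eq_card_filter_fin 1 (fun i hi _ => by simpa using hi) fun i => ?_
  have h1 := entry_succ π i.castSucc
  have h2 := entry_succ π i.succ
  have h3 : (π i.castSucc : ℕ) ≠ π i.succ := fun h =>
    i.castSucc_lt_succ.ne (π.injective (Fin.ext h))
  simp only [Fin.val_castSucc, Fin.val_succ] at h1 h2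
  simp only [mem_Ico, h1, h2, Fin.lt_def]
  have := i.isLt
  omega

theorem pdes_eq {n : ℕ} (π : Perm (Fin (n + 1))) :
    pdes π = (univ.filter fun i : Fin n => π i.succ < π i.castSucc ∧
      ∀ j, π j < π i.castSucc → i.castSucc < j).card := by
  refine card_filter_eq_card_filter_fin 1 (fun i hi h => by simpa using h.1) fun i => ?_
  have h1 := entry_succ π i.castSucc
  have h2 := entry_succ π i.succ
  simp only [Fin.val_castSucc, Fin.val_succ] at h1 h2
  simp only [IsProperDescent, forall_mem_Icc_iff]
  simp only [h1, h2, entry_succ, mem_Icc, Fin.lt_def,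
    Fin.val_castSucc, add_lt_add_iff_right]
  have := i.isLt
  constructor
  · exact fun h => h.2.2
  · exact fun h => ⟨by omega, by omega, h⟩

theorem pasc_eq {n : ℕ} (π : Perm (Fin (n + 1))) :
    pasc π = (univ.filter fun i : Fin n => ¬ π i.succ < π i.castSucc ∧
      ∀ j, π j < π i.succ → j < i.succ).card := by
  -- The offset is 2 because a proper ascent is recorded at its right end, counted from 1.
  refine card_filter_eq_card_filter_fin 2 (fun i hi h => ?_) fun i => ?_
  · have := h.1
    omega
  have h1 := entry_succ π i.castSucc
  have h2 := entry_succ π i.succ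
  have h3 : (π i.castSucc : ℕ) ≠ π i.succ := fun h =>
    i.castSucc_lt_succ.ne (π.injective (Fin.ext h))
  simp only [Fin.val_castSucc, Fin.val_succ] at h1 h2
  have h4 : (i : ℕ) + 2 - 1 = i + 1 := rfl
  simp only [IsProperAscent, forall_mem_Icc_iff]
  simp only [h1, h2, h4, entry_succ, mem_Icc, Fin.lt_def,
    Fin.val_succ, add_lt_add_iff_right, not_lt]
  have := i.isLt
  have h5 : (π i.castSucc : ℕ) ≤ π i.succ ↔ (π i.castSucc : ℕ) < π i.succ :=
    ⟨fun h => lt_of_le_of_ne h h3, le_of_lt⟩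
  rw [h5]
  constructor
  · exact fun h => h.2.2
  · exact fun h => ⟨by omega, by omega, h⟩

theorem impdes_eq {n : ℕ} (π : Perm (Fin (n + 1))) :
    impdes π = (univ.filter fun i : Fin n => π i.succ < π i.castSucc ∧
      ¬ ∀ j, π j < π i.castSucc → i.castSucc < j).card := by
  rw [impdes, desStar_eq, pdes_eq, ← filter_filter, ← filter_filter,
    ← card_filter_add_card_filter_not (s := univ.filter fun i : Fin n => π i.succ < π i.castSucc)
      fun i => ∀ j, π j < π i.castSucc → i.castSucc < j, Nat.add_sub_cancel_left]

theorem impasc_eq {n : ℕ} (π : Perm (Fin (n + 1))) :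
    impasc π = (univ.filter fun i : Fin n => ¬ π i.succ < π i.castSucc ∧
      ¬ ∀ j, π j < π i.succ → j < i.succ).card := by
  rw [impasc, ascStar_eq, pasc_eq, ← filter_filter, ← filter_filter,
    ← card_filter_add_card_filter_not
      (s := univ.filter fun i : Fin n => ¬ π i.succ < π i.castSucc)
      fun i => ∀ j, π j < π i.succ → j < i.succ, Nat.add_sub_cancel_left]

theorem des_eq {n : ℕ} (π : Perm (Fin (n + 1))) : des π = impdes π + pdes π + 1 := by
  rw [impdes, Nat.sub_add_cancel (pdes_le_desStar π), des, desStar, ← Ico_insert_right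
    (by omega : 1 ≤ n + 1), filter_insert, if_pos, card_insert_of_notMem (by simp)]
  have := entry_succ π (Fin.last n)
  rw [Fin.val_last] at this
  rw [this]
  simp [entry]

section Weight

variable {A : Type*} [CommRing A]

theorem prod_gapWeight (u u' v v' : A) {n : ℕ} (π : Perm (Fin (n + 1))) :
    ∏ i, gapWeight u u' v v' π i
      = u ^ impdes π * u' ^ pdes π * (v ^ impasc π * v' ^ pasc π) := by
  simp only [gapWeight, prod_ite, prod_const, filter_filter, impdes_eq, pdes_eq, impasc_eq,
    pasc_eq]
  ring

theorem sum_perm_refined (u u' v v' p q : A) (n : ℕ) :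
    ∑ π : Perm (Fin (n + 1)), u ^ impdes π * u' ^ pdes π * (v ^ impasc π * v' ^ pasc π) *
        (p ^ (lrmin π - 1) * q ^ (rlmin π - 1))
      = ∑ σ : Perm (Fin n), u ^ exc σ * v ^ drop σ * (p * u' + q * v') ^ fix σ *
          (p + q) ^ (cyc σ - fix σ) := by
  have h := sum_wordWeight_eq_sum_cycleWeight u u' v v' p q n
  simpa only [wordWeight, prod_gapWeight, cycleWeight, prod_arcWeight, cyc_eq,
    Nat.add_sub_cancel] using h

end Weight

end PermStat

theorem mainTheorem8 {R : Type*} [CommRing R] (n : ℕ) (x y p q : R) :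
    (∑ π : Equiv.Perm (Fin (n + 1)),
        x ^ PermStat.pdes π * y ^ PermStat.pasc π *
          p ^ (PermStat.lrmin π - 1) * q ^ (PermStat.rlmin π - 1)
      = ∑ π : Equiv.Perm (Fin n),
          (p * x + q * y) ^ PermStat.fix π * (p + q) ^ (PermStat.cyc π - PermStat.fix π)) ∧
    (∑ π : Equiv.Perm (Fin (n + 1)),
        x ^ PermStat.impdes π * y ^ PermStat.impasc π *
          p ^ (PermStat.lrmin π - 1) * q ^ (PermStat.rlmin π - 1)
      = ∑ π : Equiv.Perm (Fin n),
          x ^ PermStat.exc π * y ^ PermStat.drop π * (p + q) ^ PermStat.cyc π) ∧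
    (∑ π : Equiv.Perm (Fin (n + 1)), x ^ PermStat.impdes π * y ^ PermStat.pdes π
      = ∑ π : Equiv.Perm (Fin n),
          x ^ PermStat.exc π * (1 + y) ^ PermStat.fix π *
            2 ^ (PermStat.cyc π - PermStat.fix π)) ∧
    (PermStat.eulerian (n + 1) x
      = x * ∑ π : Equiv.Perm (Fin (n + 1)), x ^ (PermStat.impdes π + PermStat.pdes π)) ∧
    (PermStat.eulerian (n + 1) x
      = ∑ π : Equiv.Perm (Fin n),
          x ^ (PermStat.exc π + 1) * (1 + x) ^ PermStat.fix π *
            2 ^ (PermStat.cyc π - PermStat.fix π)) := by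
  have h3 (x y : R) : ∑ π : Equiv.Perm (Fin (n + 1)), x ^ PermStat.impdes π * y ^ PermStat.pdes π
      = ∑ π : Equiv.Perm (Fin n), x ^ PermStat.exc π * (1 + y) ^ PermStat.fix π *
          2 ^ (PermStat.cyc π - PermStat.fix π) := by
    simpa [add_comm, one_add_one_eq_two] using PermStat.sum_perm_refined x y 1 1 1 1 n
  have h4 : PermStat.eulerian (n + 1) x
      = x * ∑ π : Equiv.Perm (Fin (n + 1)), x ^ (PermStat.impdes π + PermStat.pdes π) := by
    simp only [PermStat.eulerian, PermStat.des_eq, pow_succ', Finset.mul_sum]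
  refine ⟨?_, ?_, h3 x y, h4, ?_⟩
  · simpa [mul_assoc] using PermStat.sum_perm_refined 1 x 1 y p q n
  · have h := PermStat.sum_perm_refined x 1 y 1 p q n
    simp only [one_pow, mul_one] at h
    simp only [mul_assoc] at h ⊢
    rw [h]
    -- With `u' = v' = 1` fixed points also weigh `p + q`, so the two powers merge.
    refine Finset.sum_congr rfl fun π _ => ?_
    rw [← pow_add, Nat.add_sub_cancel' (PermStat.fix_le_cyc π)]
  · simp only [h4, pow_add, h3 x x, Finset.mul_sum, pow_one]
    exact Finset.sum_congr rfl fun π _ => by ring
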